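/- Let $k\ge 1$ and $N\ge 1$ be integers and let $X_1,\dots,X_k$ be finite sets of cardinalities $n_1,\dots,n_k$, with indices read modulo $k$ (so $n_0=n_k$ and $X_{k+1}=X_1$). A $k$-tuple $(f_1,\dots,f_k)$ of maps $f_i:X_i\to X_{i+1}$ is called eventually $N$-cyclic if, for the composition $g=f_k\circ\cdots\circ f_1:X_1\to X_1$, the iterated images $g^m(X_1)$ are equal, for all sufficiently large $m$, to a subset $U\subseteq X_1$ of cardinality $N$ on which $g$ acts as an $N$-cycle (the identity of a one-point set being a $1$-cycle). Let $\mathsf{EC}(N)$ be the set of eventually $N$-cyclic $k$-tuples. Then \[ \#\mathsf{EC}(N)=\left(\prod_{i=1}^k\binom{n_i}{N}\right)\cdot\frac{(N!)^k}{N}\cdot\left(\prod_{i=1}^k n_i^{\,n_{i-1}-(N+1)}\right)\cdot\left(\prod_{j=1}^k n_j-\prod_{j=1}^k(n_j-N)\right), \] where exponents may be negative and the right-hand side is read as $0$ if some $n_i=0$. If moreover $n_i\ge N$ for all $i$, then equivalently \[ \#\mathsf{EC}(N)=\frac1N\left(\prod_{i=1}^k n_i^{\,n_{i-1}-N}\,\frac{(n_i-1)!}{(n_i-N)!}\right)\left(\prod_{j=1}^k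 n_j-\prod_{j=1}^k(n_j-N)\right). \] -/

import Mathlib

/-- Cyclic `k`-tuples of maps `X₁ → X₂ → ⋯ → X_k → X₁`. The index set is `Fin k`, whose addition is
modulo `k`; the index `0` plays the role of the first set. -/
abbrev CyclicTuple {k : ℕ} [NeZero k] (X : Fin k → Type*) : Type _ :=
  ∀ i : Fin k, X i → X (i + 1)

namespace CyclicTuple

theorem ofNat_add_one (k : ℕ) [NeZero k] (m : ℕ) :
    Fin.ofNat k m + 1 = Fin.ofNat k (m + 1) := by
  apply Fin.ext
  simp [Fin.ofNat, Fin.val_add]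

theorem ofNat_self (k : ℕ) [NeZero k] : Fin.ofNat k k = 0 := by
  apply Fin.ext
  simp [Fin.ofNat]

/-- The composition of the first `m` maps of the tuple, starting from the first set
(the `cast` only identifies the sets with equal indices modulo `k`). -/
def partialComp {k : ℕ} [NeZero k] {X : Fin k → Type*} (f : CyclicTuple X) :
    (m : ℕ) → X 0 → X (Fin.ofNat k m)
  | 0 => fun x => x
  | m + 1 => fun x =>
      cast (congrArg X (ofNat_add_one k m)) (f (Fin.ofNat k m) (partialComp f m x))

/-- The full composition `f_k ∘ ⋯ ∘ f_1` of the tuple, a self-map of the first set. -/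
def comp {k : ℕ} [NeZero k] {X : Fin k → Type*} (f : CyclicTuple X) : X 0 → X 0 :=
  fun x => cast (congrArg X (ofNat_self k)) (f.partialComp k x)

end CyclicTuple

/-- `g` restricts to a permutation of `U` consisting of a single cycle through all points of `U`
(so the identity of a one-point set counts as a `1`-cycle). -/
def ActsAsCycleOn {α : Type*} (g : α → α) (U : Set α) : Prop :=
  Set.BijOn g U U ∧ ∀ x ∈ U, ∀ y ∈ U, ∃ j : ℕ, g^[j] x = y

/-- The iterated images of the full composition eventually stabilize to a set with exactly `N`
elements, on which the full composition acts as an `N`-cycle. -/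
def IsEventuallyCyclic {k : ℕ} [NeZero k] {X : Fin k → Type*} (N : ℕ) (f : CyclicTuple X) : Prop :=
  ∃ U : Set (X 0), (∃ M : ℕ, ∀ m : ℕ, M ≤ m → Set.range (f.comp^[m]) = U) ∧
    U.encard = N ∧ ActsAsCycleOn f.comp U

/-- The set of eventually `N`-cyclic `k`-tuples on `X`. -/
def eventuallyCyclicTuples {k : ℕ} [NeZero k] (X : Fin k → Type*) (N : ℕ) : Set (CyclicTuple X) :=
  {f | IsEventuallyCyclic N f}

-- The periodic points of the map induced on the disjoint union of the `X i` form a family `C` on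
-- which the tuple is bijective, and every point eventually falls into `C`. Being eventually
-- `N`-cyclic means that each `C i` has `N` points and the full composition is transitive on `C 0`
-- (`isEventuallyCyclic_iff`). For fixed `C` the tuple splits (`card_isCore_transitiveOn`) into
-- bijections on `C`, of which `N! ^ k / N` compose to an `N`-cycle
-- (`card_transitive_compEquiv_mul`), and arbitrary maps on the complement that are absorbed into
-- `C`.
--
-- Absorbing families are counted through the non-absorbing ones (`card_not_absorbing`). The points
-- sent straight into the target `U` form a family `V`; removing them leaves the same problem with
-- target `V`. Since `|M \ V| + |V| = |M|`, the inductive count is a product of factors each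
-- depending on a single `V i`, so the sum over `V` factors into differentiated binomial sums.
-- Subtracting from the number of all families produces the difference of products in the formula.

universe u

/-! ### Families of maps absorbed into a target. -/

section Absorption

variable {k : ℕ} [NeZero k] {M U : Fin k → Type u}

/-- A point `x : M i` is absorbed if iterating `f` from `x` eventually exits into `U`. -/
inductive Absorbed (f : ∀ i, M i → M (i + 1) ⊕ U (i + 1)) : ∀ i, M i → Prop
  | exit {i : Fin k} {x : M i} {z : U (i + 1)} : f i x = Sum.inr z → Absorbed f i x
  | step {i : Fin k} {x : M i} {y : M (i + 1)} :
      f i x = Sum.inl y → Absorbed f (i + 1) y → Absorbed f i x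

/-- Every point of `M` is absorbed into `U`. -/
def Absorbing (f : ∀ i, M i → M (i + 1) ⊕ U (i + 1)) : Prop :=
  ∀ i x, Absorbed f i x

/-- The points outside `V`. -/
abbrev Outside (V : ∀ i, Finset (M i)) (i : Fin k) : Type u := {x // x ∉ V i}

/-- The points of `V`. -/
abbrev Inside (V : ∀ i, Finset (M i)) (i : Fin k) : Type u := {x // x ∈ V i}

/-- The map sending the points of `V` to `U` through `h`, and the other ones to `M` through `g`. -/
noncomputable def peel (V : ∀ i, Finset (M i)) (h : ∀ i, Inside V i → U (i + 1))
    (g : ∀ i, Outside V i → Outside V (i + 1) ⊕ Inside V (i + 1)) :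
    ∀ i, M i → M (i + 1) ⊕ U (i + 1) :=
  open Classical in
  fun i x => if hx : x ∈ V i then Sum.inr (h i ⟨x, hx⟩)
    else Sum.inl (Sum.elim Subtype.val Subtype.val (g i ⟨x, hx⟩))

theorem peel_of_mem {V : ∀ i, Finset (M i)} (h : ∀ i, Inside V i → U (i + 1))
    (g : ∀ i, Outside V i → Outside V (i + 1) ⊕ Inside V (i + 1))
    {i : Fin k} {x : M i} (hx : x ∈ V i) : peel V h g i x = Sum.inr (h i ⟨x, hx⟩) := by
  simp [peel, hx]

theorem peel_of_notMem {V : ∀ i, Finset (M i)} (h : ∀ i, Inside V i → U (i + 1))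
    (g : ∀ i, Outside V i → Outside V (i + 1) ⊕ Inside V (i + 1))
    {i : Fin k} {x : M i} (hx : x ∉ V i) :
    peel V h g i x = Sum.inl (Sum.elim Subtype.val Subtype.val (g i ⟨x, hx⟩)) := by
  simp [peel, hx]

theorem mem_iff_isRight_peel {V : ∀ i, Finset (M i)} (h : ∀ i, Inside V i → U (i + 1))
    (g : ∀ i, Outside V i → Outside V (i + 1) ⊕ Inside V (i + 1))
    (i : Fin k) (x : M i) : x ∈ V i ↔ (peel V h g i x).isRight := by
  by_cases hx : x ∈ V i
  · simp [peel_of_mem h g hx, hx]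
  · simp [peel_of_notMem h g hx, hx]

theorem absorbed_of_absorbed_peel {V : ∀ i, Finset (M i)} (h : ∀ i, Inside V i → U (i + 1))
    (g : ∀ i, Outside V i → Outside V (i + 1) ⊕ Inside V (i + 1))
    {i : Fin k} {x : M i} (H : Absorbed (peel V h g) i x) (hx : x ∉ V i) :
    Absorbed (M := Outside V) (U := Inside V) g i ⟨x, hx⟩ := by
  induction H with
  | exit e => simp [peel_of_notMem h g hx] at e
  | @step i x y e _ ih =>
    rw [peel_of_notMem h g hx, Sum.inl.injEq] at e
    rcases hg : g i ⟨x, hx⟩ with y' | y'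
    · rw [hg, Sum.elim_inl] at e
      subst e
      exact .step hg (ih y'.2)
    · exact .exit hg

theorem absorbed_peel {V : ∀ i, Finset (M i)} (h : ∀ i, Inside V i → U (i + 1))
    (g : ∀ i, Outside V i → Outside V (i + 1) ⊕ Inside V (i + 1))
    {i : Fin k} {x : Outside V i} (H : Absorbed (M := Outside V) (U := Inside V) g i x) :
    Absorbed (peel V h g) i x := by
  induction H with
  | @exit i x z e =>
    refine .step (y := z) ?_ (.exit (peel_of_mem h g z.2))
    rw [peel_of_notMem h g x.2, e, Sum.elim_inr]
  | @step i x y e _ ih =>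
    refine .step (y := y) ?_ ih
    rw [peel_of_notMem h g x.2, e, Sum.elim_inl]

/-- Points of `V` exit at once, and the only way into `U` is through `V`; hence `h` plays no role.
-/
theorem absorbing_peel_iff {V : ∀ i, Finset (M i)} (h : ∀ i, Inside V i → U (i + 1))
    (g : ∀ i, Outside V i → Outside V (i + 1) ⊕ Inside V (i + 1)) :
    Absorbing (peel V h g) ↔ Absorbing (M := Outside V) (U := Inside V) g := by
  refine ⟨fun H i x => absorbed_of_absorbed_peel h g (H i x) x.2, fun H i x => ?_⟩
  by_cases hx : x ∈ V i
  · exact .exit (peel_of_mem h g hx)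
  · exact absorbed_peel h g (H i ⟨x, hx⟩)

theorem exists_eq_peel [∀ i, Fintype (M i)] (f : ∀ i, M i → M (i + 1) ⊕ U (i + 1)) :
    ∃ V h g, peel V h g = f := by
  classical
  let V : ∀ i, Finset (M i) := fun i => {x | (f i x).isRight}
  have hV : ∀ i x, x ∈ V i ↔ (f i x).isRight := by simp [V]
  refine ⟨V, fun i x => (f i x).getRight ((hV i x).1 x.2), fun i x =>
    if hy : (f i x).getLeft (by simpa using (hV i x).not.1 x.2) ∈ V (i + 1)
      then Sum.inr ⟨_, hy⟩ else Sum.inl ⟨_, hy⟩, ?_⟩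
  funext i x
  by_cases hx : x ∈ V i
  · simp [peel_of_mem _ _ hx]
  · rw [peel_of_notMem _ _ hx]
    split_ifs <;> simp

/-- Every family is `peel V h g` for exactly one triple: `V` must be the set of points sent into
`U`. The map `h` is free, while `g` inherits the condition with `V` as target. -/
theorem card_not_absorbing_eq_sum [∀ i, Fintype (M i)] [∀ i, Fintype (U i)] :
    Nat.card {f : ∀ i, M i → M (i + 1) ⊕ U (i + 1) // ¬ Absorbing f} =
      ∑ V : ∀ i, Finset (M i), (∏ i, Fintype.card (U (i + 1)) ^ (V i).card) *
        Nat.card {g : ∀ i, Outside V i → Outside V (i + 1) ⊕ Inside V (i + 1) //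
          ¬ Absorbing (M := Outside V) (U := Inside V) g} := by
  classical
  let φ : (Σ V : ∀ i, Finset (M i), (∀ i, Inside V i → U (i + 1)) ×
      {g : ∀ i, Outside V i → Outside V (i + 1) ⊕ Inside V (i + 1) // ¬ Absorbing (M := Outside V) (U := Inside V) g}) →
      {f : ∀ i, M i → M (i + 1) ⊕ U (i + 1) // ¬ Absorbing f} := fun p =>
    ⟨peel p.1 p.2.1 p.2.2.1, (absorbing_peel_iff p.2.1 p.2.2.1).not.2 p.2.2.2⟩
  have hφ : Function.Bijective φ := by
    constructor
    · rintro ⟨V, h, g, hg⟩ ⟨V', h', g', hg'⟩ e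
      replace e : peel V h g = peel V' h' g' := congrArg Subtype.val e
      obtain rfl : V = V' := by
        funext i
        ext x
        rw [mem_iff_isRight_peel h g, mem_iff_isRight_peel h' g', e]
      obtain rfl : h = h' := by
        funext i x
        have := congrFun (congrFun e i) x
        rw [peel_of_mem h g x.2, peel_of_mem h' g' x.2] at this
        exact Sum.inr.inj this
      obtain rfl : g = g' := by
        funext i x
        have := congrFun (congrFun e i) x
        rw [peel_of_notMem h g x.2, peel_of_notMem h g' x.2, Sum.inl.injEq] at this
        simp only [Subtype.coe_eta] at this
        rcases hy : g i x with y | y <;> rcases hy' : g' i x with y' | y' <;>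
          rw [hy, hy'] at this <;> simp only [Sum.elim_inl, Sum.elim_inr] at this
        · rw [Subtype.ext this]
        · exact absurd (this ▸ y'.2) y.2
        · exact absurd (this ▸ y.2) y'.2
        · rw [Subtype.ext this]
      rfl
    · rintro ⟨f, hf⟩
      obtain ⟨V, h, g, rfl⟩ := exists_eq_peel f
      exact ⟨⟨V, h, g, (absorbing_peel_iff h g).not.1 hf⟩, rfl⟩
  rw [← Nat.card_congr (Equiv.ofBijective φ hφ), Nat.card_sigma]
  refine Finset.sum_congr rfl fun V _ => ?_
  rw [Nat.card_prod, Nat.card_pi]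
  congr 1
  refine Finset.prod_congr rfl fun i _ => ?_
  simp [Nat.card_eq_fintype_card]

theorem Fin.forall_of_add_one {k : ℕ} [NeZero k] {P : Fin k → Prop} (h : ∀ i, P i → P (i + 1))
    {i : Fin k} (hi : P i) (j : Fin k) : P j := by
  have key : ∀ m : ℕ, P (i + Fin.ofNat k m) := by
    intro m
    induction m with
    | zero => simpa using hi
    | succ m ih =>
      rw [← CyclicTuple.ofNat_add_one, ← add_assoc]
      exact h _ ih
  have := key (j - i).val
  simpa using this

/-- With no exit no point is absorbed, so every family counts as soon as there is a point. If some
`M i` is empty, any point would propagate around the cycle into it, so all are empty and absorption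
is vacuous. -/
theorem card_not_absorbing_of_isEmpty [∀ i, Fintype (M i)] [∀ i, IsEmpty (U i)] :
    Nat.card {f : ∀ i, M i → M (i + 1) ⊕ U (i + 1) // ¬ Absorbing f} =
      ∏ i, Fintype.card (M i) * Fintype.card (M (i + 1)) ^ (Fintype.card (M i) - 1) := by
  by_cases hM : ∀ i, Nonempty (M i)
  · have hn : ∀ (f : ∀ i, M i → M (i + 1) ⊕ U (i + 1)) i x, ¬ Absorbed f i x := by
      intro f i x H
      induction H with
      | @exit _ _ z _ => exact isEmptyElim z
      | step _ _ ih => exact ih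
    have : Nat.card {f : ∀ i, M i → M (i + 1) ⊕ U (i + 1) // ¬ Absorbing f} =
        Nat.card (∀ i, M i → M (i + 1) ⊕ U (i + 1)) :=
      Nat.card_congr (Equiv.subtypeUnivEquiv fun f H =>
        hn f 0 (Classical.arbitrary _) (H 0 _))
    have hshift : ∏ i, Fintype.card (M i) = ∏ i, Fintype.card (M (i + 1)) :=
      (Equiv.prod_comp (Equiv.addRight (1 : Fin k)) fun i => Fintype.card (M i)).symm
    rw [this, Nat.card_pi, Finset.prod_mul_distrib, hshift, ← Finset.prod_mul_distrib]
    refine Finset.prod_congr rfl fun i _ => ?_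
    have h0 : Fintype.card (M i) ≠ 0 := Fintype.card_ne_zero
    have : Nat.card (M (i + 1) ⊕ U (i + 1)) = Fintype.card (M (i + 1)) := by
      rw [Nat.card_congr (Equiv.sumEmpty _ _), Nat.card_eq_fintype_card]
    rw [Nat.card_fun, this, Nat.card_eq_fintype_card, ← pow_succ',
      Nat.sub_add_cancel (Nat.pos_of_ne_zero h0)]
  · push Not at hM
    obtain ⟨i, hi⟩ := hM
    have : IsEmpty {f : ∀ i, M i → M (i + 1) ⊕ U (i + 1) // ¬ Absorbing f} := by
      refine ⟨fun f => f.2 fun j x => ?_⟩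
      have := Fin.forall_of_add_one (P := fun i => Nonempty (M i))
        (fun i ⟨y⟩ => (f.1 i y).elim (fun z => ⟨z⟩) isEmptyElim) ⟨x⟩ i
      exact isEmptyElim this.some
    rw [Nat.card_of_isEmpty, Finset.prod_eq_zero (Finset.mem_univ i)]
    simp

/-- This is the derivative in `b` of the binomial expansion of `(a + b) ^ n`. At `V = univ` the
truncated exponent is harmless, its coefficient being zero. -/
theorem Finset.sum_powerset_univ_card_mul_pow {α : Type*} [Fintype α] (a b : ℕ) :
    ∑ V : Finset α, a ^ V.card *
      ((Fintype.card α - V.card) * b ^ (Fintype.card α - V.card - 1)) =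
      Fintype.card α * (a + b) ^ (Fintype.card α - 1) := by
  rw [← Finset.powerset_univ, Finset.sum_powerset_apply_card
    (fun m => a ^ m * ((Fintype.card α - m) * b ^ (Fintype.card α - m - 1))), Finset.card_univ]
  rcases Fintype.card α with _ | n
  · simp
  rw [Finset.sum_range_succ, Nat.add_sub_cancel, add_pow, Finset.mul_sum]
  simp only [Nat.sub_self, zero_mul, mul_zero, smul_zero, add_zero]
  refine Finset.sum_congr rfl fun j hj => ?_
  have hj : j ≤ n := Nat.lt_succ_iff.1 (Finset.mem_range.1 hj)
  rw [show n + 1 - j - 1 = n - j by omega, smul_eq_mul]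
  have h2 : (n + 1).choose j * (n + 1 - j) = (n + 1) * n.choose j := by
    have h3 := Nat.choose_mul_succ_eq n j
    rw [mul_comm (n + 1), h3]
  calc _ = ((n + 1).choose j * (n + 1 - j)) * (a ^ j * b ^ (n - j)) := by ring
    _ = _ := by rw [h2]; simp only [Nat.cast_id]; ring

/-- The number of families of maps `M i → M (i + 1) ⊕ U (i + 1)` not absorbed into `U`. -/
theorem card_not_absorbing [∀ i, Fintype (M i)] [∀ i, Fintype (U i)] :
    Nat.card {f : ∀ i, M i → M (i + 1) ⊕ U (i + 1) // ¬ Absorbing f} =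
      ∏ i, Fintype.card (M i) *
        (Fintype.card (M (i + 1)) + Fintype.card (U (i + 1))) ^ (Fintype.card (M i) - 1) := by
  classical
  induction hs : ∑ i, Fintype.card (M i) using Nat.strong_induction_on generalizing M U with
  | _ s ih =>
    rw [card_not_absorbing_eq_sum]
    have step : ∀ V : ∀ i, Finset (M i),
        Nat.card {g : ∀ i, Outside V i → Outside V (i + 1) ⊕ Inside V (i + 1) //
          ¬ Absorbing (M := Outside V) (U := Inside V) g} = ∏ i, (Fintype.card (M i) - (V i).card) *
            Fintype.card (M (i + 1)) ^ (Fintype.card (M i) - (V i).card - 1) := by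
      intro V
      have hc : ∀ i, Fintype.card {x // x ∉ V i} = Fintype.card (M i) - (V i).card := by
        intro i
        rw [Fintype.card_subtype_compl, Fintype.card_coe]
      -- If `V` is empty nothing has been removed and the induction hypothesis is unavailable, but
      -- then the new target is empty.
      by_cases hV : ∀ i, V i = ∅
      · have : ∀ i, IsEmpty {x // x ∈ V i} := fun i => ⟨fun x => by simpa [hV] using x.2⟩
        rw [card_not_absorbing_of_isEmpty]
        refine Finset.prod_congr rfl fun i _ => ?_
        rw [hc, hc]
        simp [hV]
      · push Not at hV
        obtain ⟨j, hj⟩ := hV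
        rw [ih _ ?_ rfl]
        · refine Finset.prod_congr rfl fun i _ => ?_
          rw [hc, hc, Fintype.card_coe, Nat.sub_add_cancel (Finset.card_le_univ _)]
        · rw [← hs]
          refine Finset.sum_lt_sum (fun i _ => Fintype.card_subtype_le _) ⟨j, Finset.mem_univ j, ?_⟩
          rw [hc]
          have := Finset.card_le_univ (V j)
          have := hj.card_pos
          omega
    simp only [step, ← Finset.prod_mul_distrib]
    -- The summand is a product over `i` of terms in `V i` alone, so sum and product are exchanged.
    rw [← Fintype.prod_sum (fun i (V : Finset (M i)) => Fintype.card (U (i + 1)) ^ V.card *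
      ((Fintype.card (M i) - V.card) *
        Fintype.card (M (i + 1)) ^ (Fintype.card (M i) - V.card - 1)))]
    refine Finset.prod_congr rfl fun i _ => ?_
    rw [Finset.sum_powerset_univ_card_mul_pow, add_comm (Fintype.card (U (i + 1)))]

theorem card_absorbing_add [∀ i, Fintype (M i)] [∀ i, Fintype (U i)] :
    Nat.card {f : ∀ i, M i → M (i + 1) ⊕ U (i + 1) // Absorbing f} +
      ∏ i, Fintype.card (M i) *
        (Fintype.card (M (i + 1)) + Fintype.card (U (i + 1))) ^ (Fintype.card (M i) - 1) =
      ∏ i, (Fintype.card (M (i + 1)) + Fintype.card (U (i + 1))) ^ Fintype.card (M i) := by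
  classical
  rw [← card_not_absorbing, ← Nat.card_sum, Nat.card_congr (Equiv.sumCompl _), Nat.card_pi]
  refine Finset.prod_congr rfl fun i _ => ?_
  simp [Nat.card_eq_fintype_card]

end Absorption

/-! ### Transitive permutations. -/

open Equiv in
theorem Equiv.Perm.card_transitive_mul_card {α : Type*} [Fintype α] [Nonempty α] :
    Nat.card {σ : Perm α // ∀ x y, ∃ j : ℕ, σ^[j] x = y} * Fintype.card α =
      (Fintype.card α).factorial := by
  classical
  -- `cycleType` omits fixed points, so the one-point case escapes the characterization below.
  rcases subsingleton_or_nontrivial α with hα | hα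
  · have h1 : Fintype.card α = 1 := Fintype.card_eq_one_iff_nonempty_unique.2
      ⟨⟨⟨Classical.arbitrary α⟩, fun _ => Subsingleton.elim _ _⟩⟩
    have : Nat.card {σ : Perm α // ∀ x y, ∃ j : ℕ, σ^[j] x = y} = Nat.card (Perm α) :=
      Nat.card_congr (Equiv.subtypeUnivEquiv fun σ x y => ⟨0, Subsingleton.elim _ _⟩)
    rw [this, Nat.card_eq_fintype_card, Fintype.card_perm, h1]
    simp
  · have key : ∀ σ : Perm α, (∀ x y, ∃ j : ℕ, σ^[j] x = y) ↔ σ.cycleType = {Fintype.card α} := by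
      intro σ
      constructor
      · intro H
        have hne : ∀ x, σ x ≠ x := by
          intro x hx
          obtain ⟨y, hy⟩ := exists_ne x
          obtain ⟨j, hj⟩ := H x y
          rw [Function.iterate_fixed hx] at hj
          exact hy hj.symm
        have hc : σ.IsCycle := by
          refine ⟨Classical.arbitrary α, hne _, fun y _ => ?_⟩
          obtain ⟨j, hj⟩ := H (Classical.arbitrary α) y
          refine ⟨j, ?_⟩
          rw [zpow_natCast, ← hj, Perm.iterate_eq_pow]
        rw [hc.cycleType, (Finset.eq_univ_iff_forall.2 fun x => Perm.mem_support.2 (hne x) :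
          σ.support = Finset.univ), Finset.card_univ]
      · intro H x y
        have hc : σ.IsCycle := by
          rw [← Perm.card_cycleType_eq_one, H, Multiset.card_singleton]
        have hs : σ.support = Finset.univ := by
          rw [← Finset.card_eq_iff_eq_univ]
          simpa [hc.cycleType] using H
        have hne : ∀ x, σ x ≠ x := fun x => Perm.mem_support.1 (hs ▸ Finset.mem_univ x)
        obtain ⟨j, hj⟩ := hc.exists_pow_eq (hne x) (hne y)
        exact ⟨j, by rw [Perm.iterate_eq_pow, hj]⟩
    rw [Nat.card_congr (Equiv.subtypeEquivRight key), Nat.card_eq_fintype_card,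
      Fintype.card_subtype, Perm.card_of_cycleType_singleton Fintype.one_lt_card le_rfl,
      Nat.choose_self, mul_one, mul_comm, Nat.mul_factorial_pred Fintype.card_ne_zero]

/-! ### Tuples of bijections with prescribed composition. -/

namespace CyclicTuple

variable {k : ℕ} [NeZero k] {C : Fin k → Type u}

theorem partialComp_succ (f : CyclicTuple C) (m : ℕ) (x : C 0) :
    f.partialComp (m + 1) x =
      cast (congrArg C (ofNat_add_one k m)) (f (Fin.ofNat k m) (f.partialComp m x)) :=
  rfl

theorem bijective_partialComp {f : CyclicTuple C} (hf : ∀ i, Function.Bijective (f i)) (m : ℕ) :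
    Function.Bijective (f.partialComp m) := by
  induction m with
  | zero => exact Function.bijective_id
  | succ m ih =>
    exact (Equiv.cast (congrArg C (ofNat_add_one k m))).bijective.comp ((hf _).comp ih)

theorem bijective_comp {f : CyclicTuple C} (hf : ∀ i, Function.Bijective (f i)) :
    Function.Bijective f.comp :=
  (Equiv.cast (congrArg C (ofNat_self k))).bijective.comp (bijective_partialComp hf k)

/-- The tuple of maps underlying a tuple of equivalences. -/
abbrev ofEquiv (e : ∀ i, C i ≃ C (i + 1)) : CyclicTuple C := fun i => e i

/-- The full composition of a tuple of equivalences. -/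
noncomputable def compEquiv (e : ∀ i, C i ≃ C (i + 1)) : Equiv.Perm (C 0) :=
  Equiv.ofBijective _ (bijective_comp (f := ofEquiv e) fun i => (e i).bijective)

/-- Precompose the first map of a tuple of equivalences with a permutation. -/
def precomp (σ : Equiv.Perm (C 0)) (e : ∀ i, C i ≃ C (i + 1)) : ∀ i, C i ≃ C (i + 1) :=
  Function.update e 0 (σ.trans (e 0))

theorem precomp_precomp (σ τ : Equiv.Perm (C 0)) (e : ∀ i, C i ≃ C (i + 1)) :
    precomp σ (precomp τ e) = precomp (τ * σ) e := by
  rw [precomp, precomp, precomp, Function.update_idem, Function.update_self]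
  rfl

theorem precomp_one (e : ∀ i, C i ≃ C (i + 1)) : precomp 1 e = e :=
  Function.update_eq_self_iff.2 rfl

/-- The bound `m < k` ensures that the modified map at index `0` is used only once. -/
theorem partialComp_precomp (σ : Equiv.Perm (C 0)) (e : ∀ i, C i ≃ C (i + 1)) (x : C 0) (m : ℕ)
    (hm : m < k) :
    (ofEquiv (precomp σ e)).partialComp (m + 1) x = (ofEquiv e).partialComp (m + 1) (σ x) := by
  induction m with
  | zero =>
    have : precomp σ e (Fin.ofNat k 0) = σ.trans (e 0) := Function.update_self ..
    simp only [partialComp, ofEquiv, this]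
    rfl
  | succ m ih =>
    have hne : Fin.ofNat k (m + 1) ≠ 0 := by
      intro h
      have := congrArg Fin.val h
      simp [Fin.ofNat, Nat.mod_eq_of_lt hm] at this
    have : precomp σ e (Fin.ofNat k (m + 1)) = e (Fin.ofNat k (m + 1)) :=
      Function.update_of_ne hne ..
    rw [partialComp_succ _ (m + 1), partialComp_succ _ (m + 1), ih (by omega), ofEquiv, ofEquiv, this]

theorem compEquiv_precomp (σ : Equiv.Perm (C 0)) (e : ∀ i, C i ≃ C (i + 1)) :
    compEquiv (precomp σ e) = compEquiv e * σ := by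
  ext x
  have h : ∀ m, 0 < m → m ≤ k →
      (ofEquiv (precomp σ e)).partialComp m x = (ofEquiv e).partialComp m (σ x) := by
    rintro (_ | m) h0 hm
    · omega
    · exact partialComp_precomp σ e x m hm
  change comp _ x = comp _ (σ x)
  rw [comp, comp, h k (NeZero.pos k) le_rfl]

/-- A tuple of equivalences is determined by its full composition and by the tuple with trivial
full composition obtained by changing its first map. -/
noncomputable def equivCompEquivProd (p : Equiv.Perm (C 0) → Prop) :
    {e : ∀ i, C i ≃ C (i + 1) // p (compEquiv e)} ≃
      {σ // p σ} × {e : ∀ i, C i ≃ C (i + 1) // compEquiv e = 1} where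
  toFun e := (⟨compEquiv e.1, e.2⟩, ⟨precomp (compEquiv e.1)⁻¹ e.1, by
    rw [compEquiv_precomp, mul_inv_cancel]⟩)
  invFun q := ⟨precomp q.1.1 q.2.1, by rw [compEquiv_precomp, q.2.2, one_mul]; exact q.1.2⟩
  left_inv e := by
    ext1
    simp only [precomp_precomp, inv_mul_cancel, precomp_one]
  right_inv := by
    rintro ⟨⟨σ, hσ⟩, ⟨e, he⟩⟩
    simp [compEquiv_precomp, precomp_precomp, precomp_one, he]

/-- The number of tuples of bijections between `N`-element sets composing to an `N`-cycle is
`N! ^ k / N`. -/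
theorem card_transitive_compEquiv_mul [∀ i, Fintype (C i)] {N : ℕ}
    (hC : ∀ i, Fintype.card (C i) = N) (hN : 1 ≤ N) :
    Nat.card {e : ∀ i, C i ≃ C (i + 1) // ∀ x y, ∃ j : ℕ, (ofEquiv e).comp^[j] x = y} * N =
      N.factorial ^ k := by
  classical
  have : Nonempty (C 0) := Fintype.card_pos_iff.1 (by rw [hC]; exact hN)
  -- The number of tuples with trivial composition is a common factor; taking the predicate `True`
  -- relates it to `N! ^ k`, so it need not be computed.
  have h1 := Nat.card_congr (equivCompEquivProd (C := C) fun σ => ∀ x y, ∃ j : ℕ, σ^[j] x = y)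
  have h2 := Nat.card_congr (equivCompEquivProd (C := C) fun _ => True)
  have h3 := Equiv.Perm.card_transitive_mul_card (α := C 0)
  rw [Nat.card_prod] at h1 h2
  have h4 : Nat.card {_σ : Equiv.Perm (C 0) // True} = N.factorial := by
    rw [Nat.card_congr (Equiv.subtypeUnivEquiv fun _ => trivial), Nat.card_eq_fintype_card,
      Fintype.card_perm, hC]
  have h5 : Nat.card {_e : ∀ i, C i ≃ C (i + 1) // True} = N.factorial ^ k := by
    rw [Nat.card_congr (Equiv.subtypeUnivEquiv fun _ => trivial), Nat.card_pi]
    have : ∀ i, Nat.card (C i ≃ C (i + 1)) = N.factorial := by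
      intro i
      rw [Nat.card_eq_fintype_card, Fintype.card_equiv (Fintype.equivOfCardEq
        ((hC i).trans (hC (i + 1)).symm)), hC]
    simp only [this, Finset.prod_const, Finset.card_univ, Fintype.card_fin]
  rw [hC] at h3
  rw [h4, h5] at h2
  rw [h2, ← h3, mul_right_comm, ← h1]
  rfl

end CyclicTuple

/-! ### Periodic points of self-maps of finite sets. -/

namespace Function

theorem exists_iterate_mem_periodicPts {α : Type*} [Finite α] (g : α → α) (x : α) :
    ∃ m, g^[m] x ∈ periodicPts g := by
  obtain ⟨m, n, hmn, h⟩ := Finite.exists_ne_map_eq_of_infinite fun m : ℕ => g^[m] x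
  wlog hlt : m < n generalizing m n
  · exact this n m hmn.symm h.symm (by omega)
  refine ⟨m, mk_mem_periodicPts (Nat.sub_pos_of_lt hlt) ?_⟩
  rw [IsPeriodicPt, IsFixedPt, ← iterate_add_apply, Nat.sub_add_cancel hlt.le]
  exact h.symm

theorem exists_range_iterate_eq_periodicPts {α : Type*} [Finite α] (g : α → α) :
    ∃ M, ∀ m, M ≤ m → Set.range g^[m] = periodicPts g := by
  cases nonempty_fintype α
  choose s hs using exists_iterate_mem_periodicPts g
  refine ⟨Finset.univ.sup s, fun m hm => Set.Subset.antisymm ?_ ?_⟩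
  · rintro _ ⟨x, rfl⟩
    have hx : s x ≤ m := (Finset.le_sup (Finset.mem_univ x)).trans hm
    rw [← Nat.sub_add_cancel hx, iterate_add_apply]
    exact (bijOn_periodicPts g).mapsTo.iterate _ (hs x)
  · intro y hy
    obtain ⟨x, -, rfl⟩ := (bijOn_periodicPts g).surjOn.iterate m hy
    exact ⟨x, rfl⟩

/-- Some `g^[m] x` is periodic, and injectivity on the invariant set `s` allows `g^[m]` to be
cancelled. -/
theorem mem_periodicPts_of_injOn {α : Type*} [Finite α] {g : α → α} {s : Set α}
    (hm : Set.MapsTo g s s) (hi : Set.InjOn g s) {x : α} (hx : x ∈ s) : x ∈ periodicPts g := by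
  obtain ⟨m, hmx⟩ := exists_iterate_mem_periodicPts g x
  obtain ⟨n, hn, hp⟩ := hmx
  refine ⟨n, hn, hi.iterate hm m (hm.iterate n hx) hx ?_⟩
  rw [← iterate_add_apply, add_comm, iterate_add_apply]
  exact hp

end Function

/-! ### The periodic core of a tuple. -/

namespace CyclicTuple

open Function

variable {k : ℕ} [NeZero k] {X : Fin k → Type u}

/-- The self-map of the disjoint union of the sets induced by a cyclic tuple of maps. -/
def total (f : CyclicTuple X) (p : Σ i, X i) : Σ i, X i := ⟨p.1 + 1, f p.1 p.2⟩

theorem sigma_mk_cast {ι : Type*} {Y : ι → Type*} {i j : ι} (h : i = j) (a : Y i) :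
    (⟨j, cast (congrArg Y h) a⟩ : Σ i, Y i) = ⟨i, a⟩ := by
  subst h
  rfl

theorem total_iterate_eq_partialComp (f : CyclicTuple X) (m : ℕ) (x : X 0) :
    f.total^[m] ⟨0, x⟩ = ⟨Fin.ofNat k m, f.partialComp m x⟩ := by
  induction m with
  | zero => rfl
  | succ m ih =>
    rw [iterate_succ_apply', ih, partialComp_succ, sigma_mk_cast (ofNat_add_one k m)]
    rfl

theorem total_iterate_self (f : CyclicTuple X) (x : X 0) :
    f.total^[k] ⟨0, x⟩ = ⟨0, f.comp x⟩ := by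
  rw [total_iterate_eq_partialComp, comp, sigma_mk_cast (ofNat_self k)]

theorem total_iterate_mul (f : CyclicTuple X) (j : ℕ) (x : X 0) :
    f.total^[k * j] ⟨0, x⟩ = ⟨0, f.comp^[j] x⟩ := by
  induction j with
  | zero => rfl
  | succ j ih =>
    rw [mul_add_one, add_comm, iterate_add_apply, ih, total_iterate_self, iterate_succ_apply']

theorem mem_periodicPts_comp_iff (f : CyclicTuple X) (x : X 0) :
    x ∈ periodicPts f.comp ↔ (⟨0, x⟩ : Σ i, X i) ∈ periodicPts f.total := by
  constructor
  · rintro ⟨n, hn, h⟩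
    refine ⟨k * n, Nat.mul_pos (NeZero.pos k) hn, ?_⟩
    rw [IsPeriodicPt, IsFixedPt, total_iterate_mul, h]
  · rintro ⟨n, hn, h⟩
    refine ⟨n, hn, ?_⟩
    have := h.const_mul k
    rw [IsPeriodicPt, IsFixedPt, total_iterate_mul] at this
    exact sigma_mk_injective this

/-- `f` restricts to bijections between the sets of the family `C`, and iterating `f` from any
point leads into `C`. -/
structure IsCore (f : CyclicTuple X) (C : ∀ i, Finset (X i)) : Prop where
  bijOn : ∀ i, Set.BijOn (f i) (C i) (C (i + 1))
  exists_mem : ∀ p, ∃ m, (f.total^[m] p).2 ∈ C (f.total^[m] p).1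

theorem IsCore.mem_iff [∀ i, Finite (X i)] {f : CyclicTuple X} {C : ∀ i, Finset (X i)}
    (h : f.IsCore C) (i : Fin k) (x : X i) :
    x ∈ C i ↔ (⟨i, x⟩ : Σ i, X i) ∈ periodicPts f.total := by
  have hm : Set.MapsTo f.total {p | p.2 ∈ C p.1} {p | p.2 ∈ C p.1} :=
    fun p hp => (h.bijOn p.1).mapsTo hp
  have hi : Set.InjOn f.total {p | p.2 ∈ C p.1} := by
    rintro ⟨i, x⟩ hx ⟨j, y⟩ hy e
    obtain rfl : i = j := add_right_cancel (congrArg Sigma.fst e)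
    exact congrArg _ ((h.bijOn i).injOn hx hy (sigma_mk_injective e))
  refine ⟨fun hx => mem_periodicPts_of_injOn hm hi (x := ⟨i, x⟩) hx, fun ⟨n, hn, hp⟩ => ?_⟩
  -- The orbit enters `C` after `m` steps and stays there; after `n * m` steps, a multiple of the
  -- period, it is back at the starting point.
  obtain ⟨m, hmem⟩ := h.exists_mem ⟨i, x⟩
  have h1 : f.total^[n * m - m] (f.total^[m] ⟨i, x⟩) ∈ {p : Σ i, X i | p.2 ∈ C p.1} :=
    hm.iterate _ hmem
  rwa [← iterate_add_apply, Nat.sub_add_cancel (Nat.le_mul_of_pos_left m hn),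
    hp.mul_const m] at h1

/-- The periodic points of a cyclic tuple of maps. -/
noncomputable def core [∀ i, Fintype (X i)] (f : CyclicTuple X) (i : Fin k) : Finset (X i) :=
  open Classical in {x | (⟨i, x⟩ : Σ i, X i) ∈ periodicPts f.total}

theorem mem_core [∀ i, Fintype (X i)] (f : CyclicTuple X) (i : Fin k) (x : X i) :
    x ∈ f.core i ↔ (⟨i, x⟩ : Σ i, X i) ∈ periodicPts f.total := by
  simp [core]

theorem isCore_core [∀ i, Fintype (X i)] (f : CyclicTuple X) : f.IsCore f.core where
  bijOn i := by
    refine ⟨fun x hx => ?_, fun x hx y hy e => ?_, fun y hy => ?_⟩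
    · rw [Finset.mem_coe, mem_core] at hx ⊢
      exact (bijOn_periodicPts f.total).mapsTo hx
    · rw [Finset.mem_coe, mem_core] at hx hy
      exact sigma_mk_injective
        ((bijOn_periodicPts f.total).injOn hx hy (by simp only [total, e]))
    · rw [Finset.mem_coe, mem_core] at hy
      obtain ⟨⟨j, x⟩, hx, e⟩ := (bijOn_periodicPts f.total).surjOn hy
      obtain rfl : j = i := add_right_cancel (congrArg Sigma.fst e)
      exact ⟨x, (mem_core f j x).2 hx, sigma_mk_injective e⟩
  exists_mem p := by
    obtain ⟨m, hm⟩ := exists_iterate_mem_periodicPts f.total p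
    exact ⟨m, (mem_core f _ _).2 hm⟩

theorem IsCore.eq_core [∀ i, Fintype (X i)] {f : CyclicTuple X} {C : ∀ i, Finset (X i)}
    (h : f.IsCore C) : C = f.core := by
  funext i
  ext x
  rw [h.mem_iff, mem_core]

/-- The full composition of `f` is transitive on the first set of the family `C`. -/
def TransitiveOn (f : CyclicTuple X) (C : ∀ i, Finset (X i)) : Prop :=
  ∀ x ∈ C 0, ∀ y ∈ C 0, ∃ j : ℕ, f.comp^[j] x = y

theorem isEventuallyCyclic_iff [∀ i, Fintype (X i)] (f : CyclicTuple X) (N : ℕ) :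
    IsEventuallyCyclic N f ↔ (∀ i, (f.core i).card = N) ∧ f.TransitiveOn f.core := by
  have hP : periodicPts f.comp = f.core 0 := by
    ext x
    rw [Finset.mem_coe, mem_core, mem_periodicPts_comp_iff]
  obtain ⟨M, hM⟩ := exists_range_iterate_eq_periodicPts f.comp
  -- Only the size at index `0` is prescribed; the bijections between consecutive core sets carry it
  -- around the cycle.
  have hcard : (f.core 0 : Set (X 0)).encard = N ↔ ∀ i, (f.core i).card = N := by
    rw [Set.encard_coe_eq_coe_finsetCard, Nat.cast_inj]
    refine ⟨fun h => Fin.forall_of_add_one (fun i hi => ?_) h, fun h => h 0⟩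
    rw [← hi]
    have h2 := (f.isCore_core.bijOn i).image_eq
    have h3 := (f.isCore_core.bijOn i).injOn.ncard_image
    rwa [h2, Set.ncard_coe_finset, Set.ncard_coe_finset] at h3
  constructor
  · rintro ⟨U, ⟨M', hM'⟩, hU, -, ht⟩
    obtain rfl : U = f.core 0 := by
      rw [← hP, ← hM _ (le_max_left M M'), hM' _ (le_max_right M M')]
    exact ⟨hcard.1 hU, ht⟩
  · rintro ⟨hc, ht⟩
    exact ⟨f.core 0, ⟨M, hP ▸ hM⟩, hcard.2 hc, hP ▸ bijOn_periodicPts f.comp, ht⟩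

/-! ### Splitting a tuple along its core. -/

section Glue

variable {C : ∀ i, Finset (X i)}

/-- The tuple of maps given by the equivalences `e` on `C` and by the maps `h` outside `C`. -/
noncomputable def glue (e : ∀ i, Inside C i ≃ Inside C (i + 1))
    (h : ∀ i, Outside C i → Outside C (i + 1) ⊕ Inside C (i + 1)) : CyclicTuple X :=
  open Classical in
  fun i x => if hx : x ∈ C i then (e i ⟨x, hx⟩).1
    else Sum.elim Subtype.val Subtype.val (h i ⟨x, hx⟩)

variable (e : ∀ i, Inside C i ≃ Inside C (i + 1))
  (h : ∀ i, Outside C i → Outside C (i + 1) ⊕ Inside C (i + 1))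

theorem glue_inside {i : Fin k} (x : Inside C i) : glue e h i x.1 = (e i x).1 := by
  simp [glue, x.2]

theorem glue_outside {i : Fin k} (x : Outside C i) :
    glue e h i x.1 = Sum.elim Subtype.val Subtype.val (h i x) := by
  simp [glue, x.2]

theorem bijOn_glue (i : Fin k) : Set.BijOn (glue e h i) (C i) (C (i + 1)) := by
  refine ⟨fun x hx => ?_, fun x hx y hy E => ?_, fun y hy => ?_⟩
  · rw [glue_inside e h ⟨x, hx⟩]
    exact (e i ⟨x, hx⟩).2
  · rw [glue_inside e h ⟨x, hx⟩, glue_inside e h ⟨y, hy⟩] at E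
    exact congrArg Subtype.val ((e i).injective (Subtype.ext E))
  · obtain ⟨x, hx⟩ := (e i).surjective ⟨y, hy⟩
    exact ⟨x.1, x.2, by rw [glue_inside, hx]⟩

theorem absorbed_of_iterate_mem (m : ℕ) {i : Fin k} (x : Outside C i)
    (hm : ((glue e h).total^[m] ⟨i, x.1⟩).2 ∈ C ((glue e h).total^[m] ⟨i, x.1⟩).1) :
    Absorbed (M := Outside C) (U := Inside C) h i x := by
  induction m generalizing i x with
  | zero => exact absurd hm x.2
  | succ m ih =>
    have hs : (glue e h).total ⟨i, x.1⟩ =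
        ⟨i + 1, Sum.elim Subtype.val Subtype.val (h i x)⟩ := by
      rw [← glue_outside e h x]
      rfl
    rw [iterate_succ_apply, hs] at hm
    rcases hx : h i x with y | y
    · rw [hx, Sum.elim_inl] at hm
      exact .step hx (ih y hm)
    · exact .exit hx

theorem exists_iterate_mem_of_absorbed {i : Fin k} {x : Outside C i}
    (H : Absorbed (M := Outside C) (U := Inside C) h i x) :
    ∃ m, ((glue e h).total^[m] ⟨i, x.1⟩).2 ∈ C ((glue e h).total^[m] ⟨i, x.1⟩).1 := by
  have hs : ∀ i (x : Outside C i), (glue e h).total ⟨i, x.1⟩ =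
      ⟨i + 1, Sum.elim Subtype.val Subtype.val (h i x)⟩ := by
    intro i x
    rw [← glue_outside e h x]
    rfl
  induction H with
  | @exit i x z E =>
    refine ⟨1, ?_⟩
    rw [iterate_one, hs, E]
    exact z.2
  | @step i x y E _ ih =>
    obtain ⟨m, hm⟩ := ih
    refine ⟨m + 1, ?_⟩
    rwa [iterate_succ_apply, hs, E]

theorem isCore_glue_iff :
    (glue e h).IsCore C ↔ Absorbing (M := Outside C) (U := Inside C) h := by
  constructor
  · intro H i x
    obtain ⟨m, hm⟩ := H.exists_mem ⟨i, x.1⟩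
    exact absorbed_of_iterate_mem e h m x hm
  · refine fun H => ⟨bijOn_glue e h, fun ⟨i, x⟩ => ?_⟩
    by_cases hx : x ∈ C i
    · exact ⟨0, hx⟩
    · exact exists_iterate_mem_of_absorbed e h (H i ⟨x, hx⟩)

/-- The inclusion of `C` semiconjugates the maps on the disjoint unions, which avoids handling the
casts in `comp`. -/
theorem comp_glue_iterate (x : Inside C 0) (j : ℕ) :
    (glue e h).comp^[j] x.1 = ((ofEquiv e).comp^[j] x).1 := by
  let incl : (Σ i, Inside C i) → Σ i, X i := fun p => ⟨p.1, p.2.1⟩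
  have hsemi : Semiconj incl (ofEquiv e).total (glue e h).total := by
    rintro ⟨i, x⟩
    simp only [incl, total, glue_inside]
  have := (hsemi.iterate_right (k * j)) ⟨0, x⟩
  rw [total_iterate_mul] at this
  exact (sigma_mk_injective (this.trans (total_iterate_mul _ j x.1))).symm

theorem transitiveOn_glue_iff :
    (glue e h).TransitiveOn C ↔ ∀ x y, ∃ j : ℕ, (ofEquiv e).comp^[j] x = y := by
  constructor
  · intro H x y
    obtain ⟨j, hj⟩ := H x.1 x.2 y.1 y.2
    exact ⟨j, Subtype.ext ((comp_glue_iterate e h x j).symm.trans hj)⟩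
  · intro H x hx y hy
    obtain ⟨j, hj⟩ := H ⟨x, hx⟩ ⟨y, hy⟩
    exact ⟨j, (comp_glue_iterate e h ⟨x, hx⟩ j).trans (congrArg Subtype.val hj)⟩

theorem exists_eq_glue {f : CyclicTuple X} (hf : f.IsCore C) : ∃ e h, glue (C := C) e h = f := by
  classical
  refine ⟨fun i => Equiv.ofBijective (fun x => ⟨f i x.1, (hf.bijOn i).mapsTo x.2⟩) ⟨?_, ?_⟩,
    fun i x => if hy : f i x.1 ∈ C (i + 1) then Sum.inr ⟨_, hy⟩ else Sum.inl ⟨_, hy⟩, ?_⟩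
  · intro x y E
    exact Subtype.ext ((hf.bijOn i).injOn x.2 y.2 (congrArg Subtype.val E))
  · intro y
    obtain ⟨x, hx, hxy⟩ := (hf.bijOn i).surjOn y.2
    exact ⟨⟨x, hx⟩, Subtype.ext hxy⟩
  · funext i x
    by_cases hx : x ∈ C i
    · exact glue_inside _ _ ⟨x, hx⟩
    · refine (glue_outside _ _ ⟨x, hx⟩).trans ?_
      split_ifs <;> rfl

theorem glue_injective {e e' : ∀ i, Inside C i ≃ Inside C (i + 1)}
    {h h' : ∀ i, Outside C i → Outside C (i + 1) ⊕ Inside C (i + 1)}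
    (E : glue e h = glue e' h') : e = e' ∧ h = h' := by
  constructor
  · funext i
    ext x
    rw [← glue_inside e h x, E, glue_inside]
  · funext i x
    have := congrFun (congrFun E i) x.1
    rw [glue_outside, glue_outside] at this
    rcases hy : h i x with y | y <;> rcases hy' : h' i x with y' | y' <;>
      rw [hy, hy'] at this <;> simp only [Sum.elim_inl, Sum.elim_inr] at this
    · rw [Subtype.ext this]
    · exact absurd (this ▸ y'.2) y.2
    · exact absurd (this ▸ y.2) y'.2
    · rw [Subtype.ext this]

-- `glue` is a bijection from pairs onto tuples with core `C`: transitivity constrains only `e`,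
-- absorption only `h`.
variable (C) in
theorem card_isCore_transitiveOn :
    Nat.card {f : CyclicTuple X // f.IsCore C ∧ f.TransitiveOn C} =
      Nat.card {e : ∀ i, Inside C i ≃ Inside C (i + 1) //
        ∀ x y, ∃ j : ℕ, (ofEquiv e).comp^[j] x = y} *
      Nat.card {h : ∀ i, Outside C i → Outside C (i + 1) ⊕ Inside C (i + 1) //
        Absorbing (M := Outside C) (U := Inside C) h} := by
  rw [← Nat.card_prod]
  symm
  refine Nat.card_congr (Equiv.ofBijective (fun q => ⟨glue q.1.1 q.2.1,
    (isCore_glue_iff _ _).2 q.2.2, (transitiveOn_glue_iff _ _).2 q.1.2⟩) ⟨?_, ?_⟩)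
  · rintro ⟨⟨e, he⟩, ⟨h, hh⟩⟩ ⟨⟨e', he'⟩, ⟨h', hh'⟩⟩ E
    obtain ⟨rfl, rfl⟩ := glue_injective (congrArg Subtype.val E)
    rfl
  · rintro ⟨f, hf, ht⟩
    obtain ⟨e, h, rfl⟩ := exists_eq_glue hf
    exact ⟨⟨⟨e, (transitiveOn_glue_iff e h).1 ht⟩, ⟨h, (isCore_glue_iff e h).1 hf⟩⟩, rfl⟩

end Glue

/-! ### Summation over all possible cores. -/

theorem card_eventuallyCyclicTuples_eq_sum [∀ i, Fintype (X i)] (N : ℕ) :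
    (eventuallyCyclicTuples X N).ncard =
      ∑ C : ∀ i, {s : Finset (X i) // s.card = N},
        Nat.card {f : CyclicTuple X //
          f.IsCore (fun i => (C i).1) ∧ f.TransitiveOn (fun i => (C i).1)} := by
  classical
  rw [← Nat.card_coe_set_eq, ← Nat.card_sigma]
  symm
  refine Nat.card_congr (Equiv.ofBijective (fun p => ⟨p.2.1, ?_⟩) ⟨?_, ?_⟩)
  · refine (isEventuallyCyclic_iff _ N).2 ?_
    rw [← p.2.2.1.eq_core]
    exact ⟨fun i => (p.1 i).2, p.2.2.2⟩
  · rintro ⟨C, f, hf, ht⟩ ⟨C', f', hf', ht'⟩ E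
    obtain rfl : f = f' := congrArg Subtype.val E
    obtain rfl : C = C' := by
      funext i
      exact Subtype.ext (congrFun (hf.eq_core.trans hf'.eq_core.symm) i)
    rfl
  · rintro ⟨f, hf⟩
    obtain ⟨hc, ht⟩ := (isEventuallyCyclic_iff f N).1 hf
    exact ⟨⟨fun i => ⟨f.core i, hc i⟩, f, f.isCore_core, ht⟩, rfl⟩

/-- The number of eventually `N`-cyclic tuples, as an identity of natural numbers. -/
theorem card_eventuallyCyclicTuples_mul [∀ i, Fintype (X i)] {N : ℕ} (hN : 1 ≤ N) :
    (eventuallyCyclicTuples X N).ncard * N + (∏ i, (Fintype.card (X i)).choose N) *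
        (N.factorial ^ k * ∏ i, (Fintype.card (X i) - N) *
          Fintype.card (X (i + 1)) ^ (Fintype.card (X i) - N - 1)) =
      (∏ i, (Fintype.card (X i)).choose N) *
        (N.factorial ^ k * ∏ i, Fintype.card (X (i + 1)) ^ (Fintype.card (X i) - N)) := by
  classical
  have hcard : ∏ i, (Fintype.card (X i)).choose N =
      Fintype.card (∀ i, {s : Finset (X i) // s.card = N}) := by
    rw [Fintype.card_pi]
    simp only [Fintype.card_finset_len]
  rw [card_eventuallyCyclicTuples_eq_sum, Finset.sum_mul, hcard, ← Finset.card_univ,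
    ← smul_eq_mul (a := Finset.card _), ← smul_eq_mul (a := Finset.card _), ← Finset.sum_const,
    ← Finset.sum_const, ← Finset.sum_add_distrib]
  refine Finset.sum_congr rfl fun C _ => ?_
  have hin : ∀ i, Fintype.card (Inside (fun i => (C i).1) i) = N := fun i => by
    rw [Fintype.card_coe, (C i).2]
  have hout : ∀ i, Fintype.card (Outside (fun i => (C i).1) i) = Fintype.card (X i) - N :=
    fun i => by rw [Fintype.card_subtype_compl, Fintype.card_coe, (C i).2]
  -- The existence of `C` itself gives this bound, so no size assumption is needed: otherwise the
  -- sum is empty.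
  have hle : ∀ i, N ≤ Fintype.card (X i) := fun i => by
    rw [← (C i).2]
    exact Finset.card_le_univ _
  have h1 := card_absorbing_add (M := Outside fun i => (C i).1) (U := Inside fun i => (C i).1)
  simp only [hin, hout, Nat.sub_add_cancel (hle _)] at h1
  rw [card_isCore_transitiveOn, mul_right_comm, card_transitive_compEquiv_mul hin hN, ← mul_add,
    h1]

end CyclicTuple

/-! ### From natural-number counts to the rational formulas. -/

theorem Fin.prod_add_one {k : ℕ} [NeZero k] {A : Type*} [CommMonoid A] (φ : Fin k → A) :
    ∏ i, φ (i + 1) = ∏ i, φ i :=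
  Equiv.prod_comp (Equiv.addRight (1 : Fin k)) φ

theorem prod_zpow_mul_sub {k : ℕ} [NeZero k] {n : Fin k → ℕ} {N : ℕ} (hN : 1 ≤ N)
    (hn : ∀ i, N ≤ n i) :
    (∏ i, (n i : ℚ) ^ ((n (i - 1) : ℤ) - ((N : ℤ) + 1))) *
        ((∏ j, (n j : ℚ)) - ∏ j, ((n j : ℚ) - (N : ℚ))) =
      (∏ i, n (i + 1) ^ (n i - N) : ℕ) - (∏ i, (n i - N) * n (i + 1) ^ (n i - N - 1) : ℕ) := by
  have hpos : ∀ i, (n i : ℚ) ≠ 0 := fun i => by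
    have := hn i
    exact Nat.cast_ne_zero.2 (by omega)
  rw [← Fin.prod_add_one fun i => (n i : ℚ) ^ ((n (i - 1) : ℤ) - ((N : ℤ) + 1)), mul_sub,
    ← Fin.prod_add_one fun i => (n i : ℚ), ← Finset.prod_mul_distrib, ← Finset.prod_mul_distrib]
  push_cast
  simp only [add_sub_cancel_right]
  congr 1
  · refine Finset.prod_congr rfl fun i _ => ?_
    rw [← zpow_add_one₀ (hpos _), ← zpow_natCast, Nat.cast_sub (hn i)]
    congr 1
    ring
  · refine Finset.prod_congr rfl fun i _ => ?_
    rw [mul_comm, Nat.cast_sub (hn i)]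
    -- For `n i = N` the truncated exponent differs from the integer one, but the factor `n i - N`
    -- vanishes.
    rcases (hn i).eq_or_lt with h | h
    · simp [h]
    · congr 1
      rw [← zpow_natCast, Nat.cast_sub (by omega), Nat.cast_sub (hn i)]
      congr 1
      push_cast
      ring

theorem choose_mul_factorial_mul_zpow {n N : ℕ} (hN : 1 ≤ N) (hn : N ≤ n) (a : ℤ) :
    (n.choose N : ℚ) * N.factorial * (n : ℚ) ^ (a - ((N : ℤ) + 1)) =
      (n : ℚ) ^ (a - (N : ℤ)) * (((n - 1).factorial : ℚ) / ((n - N).factorial : ℚ)) := by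
  have h0 : (n : ℚ) ≠ 0 := Nat.cast_ne_zero.2 (by omega)
  have h1 : ((n - N).factorial : ℚ) ≠ 0 := Nat.cast_ne_zero.2 (Nat.factorial_ne_zero _)
  have h2 : (n.choose N : ℚ) * N.factorial * (n - N).factorial = n * (n - 1).factorial := by
    rw [← Nat.cast_mul, ← Nat.cast_mul, ← Nat.cast_mul,
      Nat.choose_mul_factorial_mul_factorial hn, Nat.mul_factorial_pred (by omega)]
  rw [show a - (N : ℤ) = a - ((N : ℤ) + 1) + 1 by ring, zpow_add_one₀ h0, mul_div_assoc',
    eq_div_iff h1]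
  linear_combination (n : ℚ) ^ (a - ((N : ℤ) + 1)) * h2

theorem proposition4p6 (k : ℕ) [NeZero k] (X : Fin k → Type*) [∀ i, Fintype (X i)]
    (n : Fin k → ℕ) (hn : ∀ i, Fintype.card (X i) = n i) (N : ℕ) (hN : 1 ≤ N) :
    ((eventuallyCyclicTuples X N).ncard : ℚ) =
        (∏ i, ((n i).choose N : ℚ)) * ((N.factorial : ℚ) ^ k / (N : ℚ)) *
          (∏ i, (n i : ℚ) ^ ((n (i - 1) : ℤ) - ((N : ℤ) + 1))) *
          ((∏ j, (n j : ℚ)) - ∏ j, ((n j : ℚ) - (N : ℚ))) ∧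
      ((∀ i, N ≤ n i) →
        ((eventuallyCyclicTuples X N).ncard : ℚ) =
          (1 / (N : ℚ)) *
            (∏ i, (n i : ℚ) ^ ((n (i - 1) : ℤ) - (N : ℤ)) *
              (((n i - 1).factorial : ℚ) / ((n i - N).factorial : ℚ))) *
            ((∏ j, (n j : ℚ)) - ∏ j, ((n j : ℚ) - (N : ℚ)))) := by
  have hN0 : (N : ℚ) ≠ 0 := Nat.cast_ne_zero.2 (by omega)
  have hcount := CyclicTuple.card_eventuallyCyclicTuples_mul (X := X) hN
  simp only [hn] at hcount
  have main : ((eventuallyCyclicTuples X N).ncard : ℚ) =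
      (∏ i, ((n i).choose N : ℚ)) * ((N.factorial : ℚ) ^ k / (N : ℚ)) *
        (∏ i, (n i : ℚ) ^ ((n (i - 1) : ℤ) - ((N : ℤ) + 1))) *
        ((∏ j, (n j : ℚ)) - ∏ j, ((n j : ℚ) - (N : ℚ))) := by
    by_cases hle : ∀ i, N ≤ n i
    · rw [mul_assoc, prod_zpow_mul_sub hN hle, mul_div_assoc', div_mul_eq_mul_div,
        eq_div_iff hN0, ← Nat.cast_prod]
      have := congrArg (Nat.cast : ℕ → ℚ) hcount
      simp only [Nat.cast_add, Nat.cast_mul, Nat.cast_pow] at this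
      linear_combination this
    -- A vanishing binomial coefficient kills both sides, whatever value the negative powers take.
    · push Not at hle
      obtain ⟨i, hi⟩ := hle
      have h0 : ∏ i, (n i).choose N = 0 :=
        Finset.prod_eq_zero (Finset.mem_univ i) (Nat.choose_eq_zero_of_lt hi)
      rw [h0, zero_mul, zero_mul, add_zero] at hcount
      rw [← Nat.cast_prod, h0, (Nat.mul_eq_zero.1 hcount).resolve_right (by omega)]
      simp
  refine ⟨main, fun hle => main.trans ?_⟩
  congr 1
  rw [← Finset.prod_congr rfl fun i _ =>
    choose_mul_factorial_mul_zpow hN (hle i) (n (i - 1) : ℤ), Finset.prod_mul_distrib,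
    Finset.prod_mul_distrib, Finset.prod_const, Finset.card_univ, Fintype.card_fin]
  ring
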